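/- Consider a linear time-invariant plant with state matrix $A\in\mathbb R^{n\times n}$ (Hurwitz), input matrix $B\in\mathbb R^{n\times r}$ and output matrices $C_i\in\mathbb R^{p_i\times n}$, $i=1,2$, and let $\Pi_{iu}:=C_i(sI-A)^{-1}B\,|_{s=0}=-C_iA^{-1}B$ be its steady-state gains. Suppose that for every $t\ge 0$ the function $f^t:\mathbb R^r\to\mathbb R$ is $m$-strongly convex ($m>0$) with $L_f$-Lipschitz continuous gradient, $h^t:\mathbb R^{p_1}\to\mathbb R$ is convex with $L_h$-Lipschitz continuous gradient, and $g^t:\mathbb R^{p_2}\to\mathbb R\cup\{+\infty\}$ is proper, convex and lower semicontinuous. Put $\hat L_f:=L_f-m$. For $\mu,\epsilon>0$, $\rho\in\mathbb R$ and $\varphi_1,\varphi_2\ge 0$ define $$\mathbf A_{\epsilon\rho}:=\begin{bmatrix}\frac1\epsilon A&\frac1\epsilon B&0\\0&-mI&0\\0&0&-\mu I\end{bmatrix}+\rho I,\quad \mathbf B:=\begin{bmatrix}0&0&0\\-I&-\Pi_{1u}^\top&-\frac1\mu\Pi_{2u}^\top\\0&0&I\end{bmatrix},\quad \mathbf C:=\begin{bmatrix}0&I&0\\C_1&0&0\\C_2&0&\mu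 I\end{bmatrix},$$ $$\Xi_\varphi:=\begin{bmatrix}0&U\\U&V\end{bmatrix},\qquad U:=\mathrm{diag}(\varphi_1\hat L_fI,\ \varphi_2L_hI,\ I),\qquad V:=\mathrm{diag}(-2\varphi_1I,\ -2\varphi_2I,\ -2I).$$ Assume $\Pi_{2u}\Pi_{2u}^\top\succ0$, $\mu>0$ and $\mu\ge\max\{\hat L_f,L_h\}$. Then there exists $\epsilon^\star>0$ such that for every $\epsilon\in(0,\epsilon^\star)$ there exist $\rho>0$, $\varphi_1,\varphi_2\ge0$ and a symmetric matrix $\mathbf P\succ0$ with $$\begin{bmatrix}\mathbf A_{\epsilon\rho}^\top\mathbf P+\mathbf P\mathbf A_{\epsilon\rho}&\mathbf P\mathbf B\\\mathbf B^\top\mathbf P&0\end{bmatrix}+\begin{bmatrix}\mathbf C^\top&0\\0&I\end{bmatrix}\Xi_\varphi\begin{bmatrix}\mathbf C&0\\0&I\end{bmatrix}\preceq0 .$$ -/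

import Mathlib

open Matrix
open scoped NNReal

/-- A real square matrix is Hurwitz: all its complex eigenvalues have negative real part. -/
def IsHurwitz {n : ℕ} (A : Matrix (Fin n) (Fin n) ℝ) : Prop :=
  ∀ z ∈ spectrum ℂ (A.map (algebraMap ℝ ℂ)), z.re < 0

/-- The transfer function `s ↦ C (s I - A)⁻¹ B`, over any field. -/
noncomputable def transferFn {K : Type*} [Field K] {n r p : ℕ} (A : Matrix (Fin n) (Fin n) K)
    (B : Matrix (Fin n) (Fin r) K) (C : Matrix (Fin p) (Fin n) K) (s : K) :
    Matrix (Fin p) (Fin r) K :=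
  C * (s • (1 : Matrix (Fin n) (Fin n) K) - A)⁻¹ * B

/-- The steady-state (DC) gain from input to output: the transfer function at `s = 0`. -/
noncomputable def dcGain {n r p : ℕ} (A : Matrix (Fin n) (Fin n) ℝ)
    (B : Matrix (Fin n) (Fin r) ℝ) (C : Matrix (Fin p) (Fin n) ℝ) : Matrix (Fin p) (Fin r) ℝ :=
  transferFn A B C 0

/-- Extended-real-valued functions that are proper, convex (convex epigraph) and lower
semicontinuous. -/
structure IsProperConvexLSC {E : Type*} [NormedAddCommGroup E] [NormedSpace ℝ E]
    (g : E → EReal) : Prop where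
  ne_bot : ∀ y, g y ≠ ⊥
  exists_ne_top : ∃ y, g y ≠ ⊤
  convex_epigraph : Convex ℝ {q : E × ℝ | g q.1 ≤ (q.2 : EReal)}
  lowerSemicontinuous : LowerSemicontinuous g

/-- The standing assumption on the time-varying costs: for every time `t ≥ 0`, `f t` is
`m`-strongly convex with `Lf`-Lipschitz gradient, `h t` is convex with `Lh`-Lipschitz gradient,
and `g t` is proper, convex and lower semicontinuous. -/
structure CostAssumption {r p₁ p₂ : ℕ} (m : ℝ) (Lf Lh : ℝ≥0)
    (f : ℝ → EuclideanSpace ℝ (Fin r) → ℝ)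
    (h : ℝ → EuclideanSpace ℝ (Fin p₁) → ℝ)
    (g : ℝ → EuclideanSpace ℝ (Fin p₂) → EReal) : Prop where
  f_strongConvex : ∀ t, 0 ≤ t → StrongConvexOn Set.univ m (f t)
  f_differentiable : ∀ t, 0 ≤ t → Differentiable ℝ (f t)
  f_lipschitz : ∀ t, 0 ≤ t → LipschitzWith Lf (gradient (f t))
  h_convex : ∀ t, 0 ≤ t → ConvexOn ℝ Set.univ (h t)
  h_differentiable : ∀ t, 0 ≤ t → Differentiable ℝ (h t)
  h_lipschitz : ∀ t, 0 ≤ t → LipschitzWith Lh (gradient (h t))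
  g_properConvexLSC : ∀ t, 0 ≤ t → IsProperConvexLSC (g t)

/-- The `3 × 3` block matrix with the given blocks, row by row. -/
def blocks3 {a b c d e k : Type*}
    (M₁₁ : Matrix a d ℝ) (M₁₂ : Matrix a e ℝ) (M₁₃ : Matrix a k ℝ)
    (M₂₁ : Matrix b d ℝ) (M₂₂ : Matrix b e ℝ) (M₂₃ : Matrix b k ℝ)
    (M₃₁ : Matrix c d ℝ) (M₃₂ : Matrix c e ℝ) (M₃₃ : Matrix c k ℝ) :
    Matrix (a ⊕ b ⊕ c) (d ⊕ e ⊕ k) ℝ :=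
  fromBlocks M₁₁ (fromCols M₁₂ M₁₃) (fromRows M₂₁ M₃₁) (fromBlocks M₂₂ M₂₃ M₃₂ M₃₃)

section ClosedLoop

variable {n r p₁ p₂ : ℕ}

/-- Index set of the closed-loop state `(x, u, lambda)`. -/
abbrev StateIdx (n r p₂ : ℕ) : Type := Fin n ⊕ Fin r ⊕ Fin p₂

/-- Index set of the nonlinearity's input and output, split as `(u, y₁, y₂)`. -/
abbrev SignalIdx (r p₁ p₂ : ℕ) : Type := Fin r ⊕ Fin p₁ ⊕ Fin p₂

/-- The closed-loop state matrix of the plant with time-scale parameter `ε`: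
`[[A/ε, B/ε, 0], [0, -m I, 0], [0, 0, -μ I]]`. -/
noncomputable def bigA (p₂ : ℕ) (A : Matrix (Fin n) (Fin n) ℝ) (B : Matrix (Fin n) (Fin r) ℝ)
    (m μ ε : ℝ) : Matrix (StateIdx n r p₂) (StateIdx n r p₂) ℝ :=
  blocks3
    (ε⁻¹ • A) (ε⁻¹ • B) 0
    0 (-m • (1 : Matrix (Fin r) (Fin r) ℝ)) 0
    0 0 (-μ • (1 : Matrix (Fin p₂) (Fin p₂) ℝ))

/-- The shifted closed-loop state matrix `bigA + ρ I`. -/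
noncomputable def bigAShift (p₂ : ℕ) (A : Matrix (Fin n) (Fin n) ℝ)
    (B : Matrix (Fin n) (Fin r) ℝ) (m μ ε ρ : ℝ) :
    Matrix (StateIdx n r p₂) (StateIdx n r p₂) ℝ :=
  bigA p₂ A B m μ ε + ρ • (1 : Matrix (StateIdx n r p₂) (StateIdx n r p₂) ℝ)

/-- The closed-loop input matrix
`[[0, 0, 0], [-I, -Π₁ᵀ, -(1/μ) Π₂ᵀ], [0, 0, I]]`, with `Πᵢ` the steady-state gains. -/
noncomputable def bigB (A : Matrix (Fin n) (Fin n) ℝ) (B : Matrix (Fin n) (Fin r) ℝ)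
    (C₁ : Matrix (Fin p₁) (Fin n) ℝ) (C₂ : Matrix (Fin p₂) (Fin n) ℝ) (μ : ℝ) :
    Matrix (StateIdx n r p₂) (SignalIdx r p₁ p₂) ℝ :=
  blocks3
    0 0 0
    (-1) (-(dcGain A B C₁)ᵀ) (-(1 / μ) • (dcGain A B C₂)ᵀ)
    0 0 1

/-- The closed-loop output matrix `[[0, I, 0], [C₁, 0, 0], [C₂, 0, μ I]]`. -/
def bigC (r : ℕ) (C₁ : Matrix (Fin p₁) (Fin n) ℝ) (C₂ : Matrix (Fin p₂) (Fin n) ℝ) (μ : ℝ) :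
    Matrix (SignalIdx r p₁ p₂) (StateIdx n r p₂) ℝ :=
  blocks3
    0 1 0
    C₁ 0 0
    C₂ 0 (μ • (1 : Matrix (Fin p₂) (Fin p₂) ℝ))

/-- The multiplier `[[0, U], [U, V]]` with `U = diag(φ₁ L̂f I, φ₂ Lh I, I)` and
`V = diag(-2 φ₁ I, -2 φ₂ I, -2 I)`. -/
def multiplier (r p₁ p₂ : ℕ) (Lfhat Lh φ₁ φ₂ : ℝ) :
    Matrix (SignalIdx r p₁ p₂ ⊕ SignalIdx r p₁ p₂) (SignalIdx r p₁ p₂ ⊕ SignalIdx r p₁ p₂) ℝ :=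
  let U : Matrix (SignalIdx r p₁ p₂) (SignalIdx r p₁ p₂) ℝ :=
    blocks3
      ((φ₁ * Lfhat) • (1 : Matrix (Fin r) (Fin r) ℝ)) 0 0
      0 ((φ₂ * Lh) • (1 : Matrix (Fin p₁) (Fin p₁) ℝ)) 0
      0 0 1
  let V : Matrix (SignalIdx r p₁ p₂) (SignalIdx r p₁ p₂) ℝ :=
    blocks3
      ((-2 * φ₁) • (1 : Matrix (Fin r) (Fin r) ℝ)) 0 0
      0 ((-2 * φ₂) • (1 : Matrix (Fin p₁) (Fin p₁) ℝ)) 0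
      0 0 ((-2 : ℝ) • (1 : Matrix (Fin p₂) (Fin p₂) ℝ))
  fromBlocks 0 U U V

end ClosedLoop

/-- The left-hand side of the linear matrix inequality,
`[[AᵀP + PA, PB], [BᵀP, 0]] + [[Cᵀ, 0], [0, I]] Ξ [[C, 0], [0, I]]`. -/
def lmiMatrix {σ τ : Type*} [Fintype σ] [Fintype τ] [DecidableEq τ]
    (A : Matrix σ σ ℝ) (B : Matrix σ τ ℝ) (C : Matrix τ σ ℝ)
    (P : Matrix σ σ ℝ) (Ξ : Matrix (τ ⊕ τ) (τ ⊕ τ) ℝ) : Matrix (σ ⊕ τ) (σ ⊕ τ) ℝ :=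
  fromBlocks (Aᵀ * P + P * A) (P * B) (Bᵀ * P) 0 +
    fromBlocks Cᵀ 0 0 (1 : Matrix τ τ ℝ) * Ξ * fromBlocks C 0 0 (1 : Matrix τ τ ℝ)

/-- The linear matrix inequality: its left-hand side is negative semidefinite. (The feedthrough
matrix of the closed loop is zero and does not enter.) -/
def SatisfiesLMI {σ τ : Type*} [Fintype σ] [Fintype τ] [DecidableEq τ]
    (A : Matrix σ σ ℝ) (B : Matrix σ τ ℝ) (C : Matrix τ σ ℝ)
    (P : Matrix σ σ ℝ) (Ξ : Matrix (τ ⊕ τ) (τ ⊕ τ) ℝ) : Prop :=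
  (-lmiMatrix A B C P Ξ).PosSemidef

/-!
The proof exhibits a quadratic storage function. Let `Π₁ = G`, `Π₂ = T` be the steady-state gains
and `H = -A⁻¹ B`, so that `G = C₁ H` and `T = C₂ H`. In the coordinates `ξ = x - H u` (deviation
of the plant from its quasi-steady state) and `e = w₃ - μ λ` (which equals `λ'`), take
`V = ξᵀ X ξ + μ |u|² + μ |λ|² + 2 q (T u) · λ`, where `X` solves a Lyapunov inequality for `A`.

* *Slow part* (`ξ = 0`). With equal weights `μ` on `u` and `λ`, all products of `u`, `λ` and `e`
  coming from `V' / 2` are cancelled by the sector term `y₃ · w₃ - |w₃|²`, and what is left is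
  `-μ m |u|² - |e|²` plus, for `i = 1, 2`, the sector terms `(φᵢ Lᵢ - μ) yᵢ · wᵢ - φᵢ |wᵢ|²`,
  where `(L₁, L₂) = (Lf - m, Lh)` and `(y₁, y₂) = (u, G u)`. The choice `φᵢ = μ / Lᵢ` removes the
  product (if `Lᵢ = 0`, a large `φᵢ` dominates it); see `exists_sector_weight`. The cross term of
  `V / 2` contributes `-q |Tᵀ λ|²`, which is negative definite in `λ` because `T Tᵀ` is positive
  definite, and errors of size `q` in the variables already damped. Thus a small `q > 0` gives
  strict dissipation in every variable: `exists_reduced_dissipation`.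
* *Fast part*. `ξ` is damped at rate `1 / ε` and is coupled to the slow variables by terms not
  depending on `ε`, so Young's inequality absorbs the coupling for small `ε`
  (`exists_coupling_le`), and the remaining margin allows a small shift `ρ > 0`.

The matrix `X` is built in `IsHurwitz.exists_lyapunov` without matrix exponentials: the Cayley
transform `M = (1 + A) (1 - A)⁻¹` has its spectrum in the open unit disk, so Gelfand's formula makes
some power `M ^ k` contractive, and `X = ∑ j < k, (M ^ j)ᵀ M ^ j` works. That `Lf ≥ m` when there is
at least one input follows from strong convexity (`StrongConvexOn.le_of_lipschitzWith_gradient`).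
-/

/-! ### Bounds for quadratic and bilinear forms -/

section Bounds
variable {ι κ : Type*} [Fintype ι] [Fintype κ]

theorem dotProduct_self_pos_real {x : ι → ℝ} (hx : x ≠ 0) : 0 < x ⬝ᵥ x := by
  simpa using dotProduct_star_self_pos_iff.2 hx

theorem dotProduct_self_nonneg_real (x : ι → ℝ) : 0 ≤ x ⬝ᵥ x := by
  simpa using dotProduct_star_self_nonneg x

/-- The operator norm is at most the Frobenius norm. -/
theorem mulVec_dotProduct_self_le (M : Matrix ι κ ℝ) (y : κ → ℝ) :
    (M *ᵥ y) ⬝ᵥ (M *ᵥ y) ≤ (∑ i, ∑ j, M i j ^ 2) * (y ⬝ᵥ y) := by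
  simp only [dotProduct, mulVec, Finset.sum_mul (s := (Finset.univ : Finset ι)), ← pow_two]
  exact Finset.sum_le_sum fun i _ ↦ Finset.sum_mul_sq_le_sq_mul_sq _ _ _

theorem exists_mulVec_dotProduct_self_le (M : Matrix ι κ ℝ) :
    ∃ K : ℝ, 0 < K ∧ ∀ y, (M *ᵥ y) ⬝ᵥ (M *ᵥ y) ≤ K * (y ⬝ᵥ y) := by
  refine ⟨(∑ i, ∑ j, M i j ^ 2) + 1,
    add_pos_of_nonneg_of_pos (Finset.sum_nonneg fun _ _ ↦ Finset.sum_nonneg fun _ _ ↦ sq_nonneg _)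
      one_pos, fun y ↦ ?_⟩
  linarith [mulVec_dotProduct_self_le M y, dotProduct_self_nonneg_real y]

theorem dotProduct_le_young (x y : ι → ℝ) {t : ℝ} (ht : 0 < t) :
    x ⬝ᵥ y ≤ t⁻¹ * (x ⬝ᵥ x) + t * (y ⬝ᵥ y) := by
  simp only [dotProduct, Finset.mul_sum, ← Finset.sum_add_distrib]
  refine Finset.sum_le_sum fun i _ ↦ ?_
  have h1 : t⁻¹ * t = 1 := inv_mul_cancel₀ ht.ne'
  have h2 : 0 ≤ t⁻¹ * (x i - t * y i / 2) ^ 2 := by positivity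
  have h3 : t⁻¹ * (x i - t * y i / 2) ^ 2 =
      t⁻¹ * (x i * x i) - (t⁻¹ * t) * (x i * y i) + (t⁻¹ * t) * (t * (y i * y i)) / 4 := by ring
  have h4 : 0 ≤ t * (y i * y i) := mul_nonneg ht.le (mul_self_nonneg _)
  rw [h1] at h3
  linarith

/-- Young's inequality for a bilinear form: the weight on the second argument can be made
arbitrarily small. -/
theorem exists_dotProduct_mulVec_le (M : Matrix ι κ ℝ) {t : ℝ} (ht : 0 < t) :
    ∃ K : ℝ, 0 < K ∧ ∀ x y, x ⬝ᵥ (M *ᵥ y) ≤ K * (x ⬝ᵥ x) + t * (y ⬝ᵥ y) := by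
  obtain ⟨K, hK, h⟩ := exists_mulVec_dotProduct_self_le M
  refine ⟨(t / K)⁻¹, by positivity, fun x y ↦ ?_⟩
  have h1 := dotProduct_le_young x (M *ᵥ y) (t := t / K) (by positivity)
  have h2 : t / K * ((M *ᵥ y) ⬝ᵥ (M *ᵥ y)) ≤ t / K * (K * (y ⬝ᵥ y)) :=
    mul_le_mul_of_nonneg_left (h y) (by positivity)
  have h3 : t / K * (K * (y ⬝ᵥ y)) = t * (y ⬝ᵥ y) := by field_simp
  linarith

/-- A positive definite matrix is bounded below by a positive multiple of the identity. -/
theorem Matrix.PosDef.exists_le_dotProduct_mulVec {M : Matrix ι ι ℝ} (hM : M.PosDef) :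
    ∃ c : ℝ, 0 < c ∧ ∀ x, c * (x ⬝ᵥ x) ≤ x ⬝ᵥ (M *ᵥ x) := by
  classical
  obtain ⟨K, hK, h⟩ := exists_dotProduct_mulVec_le M⁻¹ (t := 1) one_pos
  have hdet : IsUnit M.det := (M.isUnit_iff_isUnit_det).1 hM.isUnit
  refine ⟨(K + 1)⁻¹, by positivity, fun x ↦ ?_⟩
  set s := (K + 1)⁻¹ with hs
  have hsK : s * (K + 1) = 1 := inv_mul_cancel₀ (by positivity)
  have hs0 : 0 < s := by positivity
  -- expand the form at `x - s M⁻¹ x` with `s = 1 / (K + 1)`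
  have h0 : 0 ≤ (x - s • (M⁻¹ *ᵥ x)) ⬝ᵥ (M *ᵥ (x - s • (M⁻¹ *ᵥ x))) := by
    simpa using hM.posSemidef.dotProduct_mulVec_nonneg (x - s • (M⁻¹ *ᵥ x))
  have hsymm : Mᵀ = M := by simpa [IsHermitian] using hM.isHermitian
  have h1 : M *ᵥ (M⁻¹ *ᵥ x) = x := by
    rw [mulVec_mulVec, mul_nonsing_inv _ hdet, one_mulVec]
  have h2 : (M⁻¹ *ᵥ x) ⬝ᵥ (M *ᵥ x) = x ⬝ᵥ x := by
    rw [dotProduct_mulVec, ← mulVec_transpose, hsymm, h1]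
  have h3 := h x x
  have h4 : (M⁻¹ *ᵥ x) ⬝ᵥ x = x ⬝ᵥ (M⁻¹ *ᵥ x) := dotProduct_comm _ _
  simp only [mulVec_sub, mulVec_smul, h1, sub_dotProduct, dotProduct_sub, smul_dotProduct,
    dotProduct_smul, smul_eq_mul, h2, h4] at h0
  have h5 : s * (s * (x ⬝ᵥ (M⁻¹ *ᵥ x))) ≤ s * (s * ((K + 1) * (x ⬝ᵥ x))) := by
    gcongr
    linarith
  have h6 : s * (s * ((K + 1) * (x ⬝ᵥ x))) = s * (x ⬝ᵥ x) := by
    rw [← mul_assoc s (K + 1), hsK, one_mul]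
  linarith

theorem Matrix.posDef_of_forall {M : Matrix ι ι ℝ} (h : Mᵀ = M)
    (hpos : ∀ x, x ≠ 0 → 0 < x ⬝ᵥ (M *ᵥ x)) : M.PosDef :=
  Matrix.PosDef.of_dotProduct_mulVec_pos (by simpa [IsHermitian] using h)
    (fun x hx ↦ by simpa using hpos x hx)
end Bounds

/-! ### The Lyapunov inequality for Hurwitz matrices -/

open Filter Topology in
/-- By Gelfand's formula, powers of an element with spectrum in the open unit disk tend to zero. -/
theorem tendsto_pow_zero_of_spectrum_lt_one {R : Type*} [NormedRing R] [NormedAlgebra ℂ R]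
    [CompleteSpace R] {a : R} (ha : ∀ z ∈ spectrum ℂ a, ‖z‖ < 1) :
    Tendsto (fun k : ℕ ↦ a ^ k) atTop (𝓝 0) := by
  nontriviality R
  have h1 : spectralRadius ℂ a < ((1 : ℝ≥0) : ENNReal) :=
    spectrum.spectralRadius_lt_of_forall_lt a fun z hz ↦ by
      simpa [← NNReal.coe_lt_coe] using ha z hz
  obtain ⟨s, hs, hs1⟩ := ENNReal.lt_iff_exists_nnreal_btwn.1 h1
  have h2 := (spectrum.pow_nnnorm_pow_one_div_tendsto_nhds_spectralRadius a).eventually_lt_const hs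
  have h3 : ∀ᶠ k : ℕ in atTop, ‖a ^ k‖ ≤ (s : ℝ) ^ k := by
    filter_upwards [h2, eventually_gt_atTop 0] with k hk hk0
    have hk' := ENNReal.rpow_le_rpow hk.le (Nat.cast_nonneg (α := ℝ) k)
    rw [← ENNReal.rpow_mul, one_div_mul_cancel (by positivity), ENNReal.rpow_one,
      ENNReal.rpow_natCast] at hk'
    exact_mod_cast hk'
  refine squeeze_zero_norm' h3 (tendsto_pow_atTop_nhds_zero_of_lt_one s.2 ?_)
  exact_mod_cast hs1

section
variable {n : ℕ}

theorem IsHurwitz.isUnit_det {A : Matrix (Fin n) (Fin n) ℝ} (hA : IsHurwitz A) :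
    IsUnit A.det := by
  rw [isUnit_iff_ne_zero]
  intro h0
  have h : (0 : ℂ) ∈ spectrum ℂ (A.map (algebraMap ℝ ℂ)) := by
    rw [spectrum.zero_mem_iff, isUnit_iff_isUnit_det]
    have := RingHom.map_det (algebraMap ℝ ℂ) A
    rw [h0, map_zero] at this
    simpa using this.symm
  simpa using hA 0 h

/-- The Cayley transform `M = (1 + A) (1 - A)⁻¹` of a Hurwitz matrix has its spectrum in the open
unit disk: an eigenvalue `z` of `M` corresponds to the eigenvalue `(z - 1) / (z + 1)` of `A`. -/
theorem IsHurwitz.norm_lt_one_of_mem_spectrum {A M : Matrix (Fin n) (Fin n) ℝ} (hA : IsHurwitz A)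
    (hM : M * (1 - A) = 1 + A) {z : ℂ} (hz : z ∈ spectrum ℂ (M.map (algebraMap ℝ ℂ))) :
    ‖z‖ < 1 := by
  set A' := A.map (algebraMap ℝ ℂ) with hA'
  set M' := M.map (algebraMap ℝ ℂ) with hM'
  have hMC : M' * (1 - A') = 1 + A' := by
    have := congrArg (algebraMap ℝ ℂ).mapMatrix hM
    rwa [map_mul, map_sub, map_add, map_one] at this
  rw [spectrum.mem_iff, isUnit_iff_isUnit_det, isUnit_iff_ne_zero, not_not] at hz
  have key : (algebraMap ℂ (Matrix (Fin n) (Fin n) ℂ) z - M') * (1 - A') =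
      (z - 1) • (1 : Matrix (Fin n) (Fin n) ℂ) - (z + 1) • A' := by
    rw [sub_mul, hMC, Algebra.algebraMap_eq_smul_one]
    simp only [smul_mul_assoc, one_mul, smul_sub, sub_smul, add_smul, one_smul]
    abel
  have hdet : ((z - 1) • (1 : Matrix (Fin n) (Fin n) ℂ) - (z + 1) • A').det = 0 := by
    rw [← key, det_mul, hz, zero_mul]
  -- for `z = -1` the matrix in `hdet` is `-2`, which is nonsingular
  by_cases h1 : z + 1 = 0
  · have hz1 : z = -1 := eq_neg_of_add_eq_zero_left h1
    exfalso
    rw [h1, zero_smul, sub_zero, det_smul, det_one, mul_one, hz1] at hdet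
    norm_num at hdet
  · have hmem : (z - 1) / (z + 1) ∈ spectrum ℂ A' := by
      rw [spectrum.mem_iff, isUnit_iff_isUnit_det, isUnit_iff_ne_zero, not_not]
      have : (z - 1) • (1 : Matrix (Fin n) (Fin n) ℂ) - (z + 1) • A' =
          (z + 1) • (algebraMap ℂ (Matrix (Fin n) (Fin n) ℂ) ((z - 1) / (z + 1)) - A') := by
        rw [Algebra.algebraMap_eq_smul_one, smul_sub, smul_smul, mul_div_cancel₀ _ h1]
      rw [this, det_smul] at hdet
      exact (mul_eq_zero.1 hdet).resolve_left (pow_ne_zero _ h1)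
    -- the real part of `(z - 1) / (z + 1)` is `(‖z‖ ^ 2 - 1) / ‖z + 1‖ ^ 2`
    have hre := hA _ hmem
    rw [Complex.div_re, ← add_div, div_neg_iff] at hre
    have hpos : 0 < Complex.normSq (z + 1) := Complex.normSq_pos.2 h1
    have hlt : (z - 1).re * (z + 1).re + (z - 1).im * (z + 1).im < 0 := by
      rcases hre with h | h <;> linarith [h.1, h.2]
    have : ‖z‖ ^ 2 < 1 := by
      rw [← Complex.normSq_eq_norm_sq, Complex.normSq_apply]
      simp at hlt
      linarith
    nlinarith [norm_nonneg z]

/-- A real matrix with spectrum in the open unit disk has a power contracting the Euclidean norm. -/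
theorem exists_pow_mulVec_dotProduct_self_le {M : Matrix (Fin n) (Fin n) ℝ}
    (hM : ∀ z ∈ spectrum ℂ (M.map (algebraMap ℝ ℂ)), ‖z‖ < 1) :
    ∃ k : ℕ, ∀ v : Fin n → ℝ, ((M ^ k) *ᵥ v) ⬝ᵥ ((M ^ k) *ᵥ v) ≤ (1 / 2) * (v ⬝ᵥ v) := by
  let : NormedRing (Matrix (Fin n) (Fin n) ℂ) := Matrix.linftyOpNormedRing
  let : NormedAlgebra ℂ (Matrix (Fin n) (Fin n) ℂ) := Matrix.linftyOpNormedAlgebra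
  have h1 := tendsto_pow_zero_of_spectrum_lt_one hM
  have h2 : Filter.Tendsto
      (fun k : ℕ ↦ ∑ i, ∑ j, ‖((M.map (algebraMap ℝ ℂ)) ^ k) i j‖ ^ 2) Filter.atTop
      (nhds (∑ i : Fin n, ∑ j : Fin n, ‖(0 : Matrix (Fin n) (Fin n) ℂ) i j‖ ^ 2)) :=
    tendsto_finsetSum _ fun i _ ↦ tendsto_finsetSum _ fun j _ ↦
      (((continuous_id.matrix_elem i j).tendsto _).comp h1).norm.pow 2
  simp only [Matrix.zero_apply, norm_zero, ne_eq, OfNat.ofNat_ne_zero, not_false_eq_true, zero_pow,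
    Finset.sum_const_zero] at h2
  obtain ⟨k, hk⟩ := (h2.eventually_lt_const (u := 1 / 2) (by norm_num)).exists
  refine ⟨k, fun v ↦ ?_⟩
  have h3 : ∀ i j, ‖((M.map (algebraMap ℝ ℂ)) ^ k) i j‖ ^ 2 = ((M ^ k) i j) ^ 2 := by
    intro i j
    have : (M.map (algebraMap ℝ ℂ)) ^ k = (M ^ k).map (algebraMap ℝ ℂ) := by
      simpa using (map_pow (algebraMap ℝ ℂ).mapMatrix M k).symm
    rw [this]
    simp
  simp only [h3] at hk
  have h4 := mulVec_dotProduct_self_le (M ^ k) v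
  have h5 := mul_le_mul_of_nonneg_right hk.le (dotProduct_self_nonneg_real v)
  linarith

/-- Lyapunov's theorem, in the form of a strict inequality. -/
theorem IsHurwitz.exists_lyapunov {A : Matrix (Fin n) (Fin n) ℝ} (hA : IsHurwitz A) :
    ∃ X : Matrix (Fin n) (Fin n) ℝ, X.PosDef ∧ ∃ c : ℝ, 0 < c ∧
      ∀ x, (X *ᵥ x) ⬝ᵥ (A *ᵥ x) ≤ -c * (x ⬝ᵥ x) := by
  have hdet : IsUnit (1 - A).det := by
    rw [isUnit_iff_ne_zero]
    intro h0
    have h : (1 : ℂ) ∈ spectrum ℂ (A.map (algebraMap ℝ ℂ)) := by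
      rw [spectrum.mem_iff, isUnit_iff_isUnit_det, isUnit_iff_ne_zero, not_not]
      have := RingHom.map_det (algebraMap ℝ ℂ) (1 - A)
      rw [h0, map_zero, map_sub, map_one] at this
      simpa using this.symm
    have := hA 1 h
    norm_num at this
  set M := (1 + A) * (1 - A)⁻¹ with hMdef
  have hM : M * (1 - A) = 1 + A := by
    rw [hMdef, Matrix.mul_assoc, nonsing_inv_mul _ hdet, Matrix.mul_one]
  obtain ⟨k, hk⟩ := exists_pow_mulVec_dotProduct_self_le fun z hz ↦
    hA.norm_lt_one_of_mem_spectrum hM hz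
  obtain ⟨K, hK, hKinv⟩ := exists_mulVec_dotProduct_self_le (1 - A)⁻¹
  set X := ∑ j ∈ Finset.range k, (M ^ j)ᵀ * M ^ j with hX
  have hXform : ∀ v, v ⬝ᵥ (X *ᵥ v) =
      ∑ j ∈ Finset.range k, ((M ^ j) *ᵥ v) ⬝ᵥ ((M ^ j) *ᵥ v) := by
    intro v
    rw [hX, sum_mulVec, dotProduct_sum]
    refine Finset.sum_congr rfl fun j _ ↦ ?_
    rw [← mulVec_mulVec, dotProduct_mulVec, vecMul_transpose]
  have hXsymm : Xᵀ = X := by simp [hX, transpose_sum]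
  -- telescoping: `X - Mᵀ X M = 1 - (M ^ k)ᵀ M ^ k`
  have hstein : ∀ v, v ⬝ᵥ (X *ᵥ v) - (M *ᵥ v) ⬝ᵥ (X *ᵥ (M *ᵥ v)) =
      v ⬝ᵥ v - ((M ^ k) *ᵥ v) ⬝ᵥ ((M ^ k) *ᵥ v) := by
    intro v
    rw [hXform, hXform, ← Finset.sum_sub_distrib]
    simp only [mulVec_mulVec, ← pow_succ]
    have := Finset.sum_range_sub' (fun j ↦ ((M ^ j) *ᵥ v) ⬝ᵥ ((M ^ j) *ᵥ v)) k
    simpa using this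
  have hXnonneg : ∀ v, 0 ≤ v ⬝ᵥ (X *ᵥ v) := fun v ↦ by
    rw [hXform]
    exact Finset.sum_nonneg fun j _ ↦ dotProduct_self_nonneg_real _
  refine ⟨X, Matrix.posDef_of_forall hXsymm fun v hv ↦ ?_, (8 * K)⁻¹, by positivity, fun x ↦ ?_⟩
  · linarith [hstein v, hk v, hXnonneg (M *ᵥ v), dotProduct_self_pos_real hv]
  · have h1 := hstein ((1 - A) *ᵥ x)
    -- at `(1 - A) x` the left side of `hstein` becomes `-4 (X x) · (A x)`, as `M (1 - A) = 1 + A`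
    have h2 := hk ((1 - A) *ᵥ x)
    have h3 := hKinv ((1 - A) *ᵥ x)
    rw [mulVec_mulVec (v := x) (M := (1 - A)⁻¹), nonsing_inv_mul _ hdet, one_mulVec] at h3
    rw [mulVec_mulVec (v := x) (M := M), hM] at h1
    have hcomm : x ⬝ᵥ (X *ᵥ (A *ᵥ x)) = (X *ᵥ x) ⬝ᵥ (A *ᵥ x) := by
      rw [dotProduct_mulVec, ← mulVec_transpose, hXsymm]
    have h4 : ((1 - A) *ᵥ x) ⬝ᵥ (X *ᵥ ((1 - A) *ᵥ x)) -
        ((1 + A) *ᵥ x) ⬝ᵥ (X *ᵥ ((1 + A) *ᵥ x)) = -4 * ((X *ᵥ x) ⬝ᵥ (A *ᵥ x)) := by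
      simp only [sub_mulVec, add_mulVec, one_mulVec, mulVec_sub, mulVec_add, sub_dotProduct,
        add_dotProduct, dotProduct_sub, dotProduct_add, hcomm, dotProduct_comm (A *ᵥ x) (X *ᵥ x)]
      ring
    have h5 : (8 * K)⁻¹ * (x ⬝ᵥ x) ≤ (8 * K)⁻¹ * (K * (((1 - A) *ᵥ x) ⬝ᵥ ((1 - A) *ᵥ x))) := by
      gcongr
    have h6 : (8 * K)⁻¹ * (K * (((1 - A) *ᵥ x) ⬝ᵥ ((1 - A) *ᵥ x))) =
        (1 / 8) * (((1 - A) *ᵥ x) ⬝ᵥ ((1 - A) *ᵥ x)) := by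
      field_simp
    linarith
end

/-! ### Strong convexity and Lipschitz gradients -/

/-- The strong convexity modulus is at most any Lipschitz constant of the gradient. -/
theorem StrongConvexOn.le_of_lipschitzWith_gradient {E : Type*} [NormedAddCommGroup E]
    [InnerProductSpace ℝ E] [CompleteSpace E] [Nontrivial E] {m : ℝ} {L : ℝ≥0} {f : E → ℝ}
    (hf : StrongConvexOn Set.univ m f) (hd : Differentiable ℝ f)
    (hL : LipschitzWith L (gradient f)) : m ≤ L := by
  obtain ⟨e, he⟩ := exists_norm_eq E zero_le_one
  -- restrict `f - m / 2 * ‖·‖ ^ 2` to the line spanned by the unit vector `e`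
  have hline : ∀ s : ℝ, ‖s • e‖ ^ 2 = s ^ 2 := fun s ↦ by simp [norm_smul, he]
  have hconv : ConvexOn ℝ Set.univ fun s : ℝ ↦ f (s • e) - m / 2 * s ^ 2 := by
    have := (strongConvexOn_iff_convex.1 hf).comp_linearMap (LinearMap.toSpanSingleton ℝ E e)
    simpa [Function.comp_def, hline] using this
  have hderiv : ∀ s : ℝ, HasDerivAt (fun s : ℝ ↦ f (s • e) - m / 2 * s ^ 2)
      (inner ℝ (gradient f (s • e)) e - m * s) s := by
    intro s
    have h1 : HasDerivAt (fun s : ℝ ↦ s • e) e s := by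
      simpa using (hasDerivAt_id s).smul_const e
    have h2 := (hd (s • e)).hasGradientAt.hasFDerivAt.comp_hasDerivAt s h1
    have h3 := ((hasDerivAt_id s).pow 2).const_mul (m / 2)
    refine (h2.sub h3).congr_deriv ?_
    simp
    ring
  have hmono := hconv.monotoneOn_deriv fun s _ ↦ (hderiv s).differentiableAt
  have h01 := hmono (Set.mem_univ 0) (Set.mem_univ 1) zero_le_one
  rw [(hderiv 0).deriv, (hderiv 1).deriv] at h01
  have hcs := real_inner_le_norm (gradient f ((1 : ℝ) • e) - gradient f ((0 : ℝ) • e)) e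
  have hlip := hL.dist_le_mul ((1 : ℝ) • e) ((0 : ℝ) • e)
  rw [dist_eq_norm, dist_eq_norm, ← sub_smul, sub_zero, one_smul, he, mul_one] at hlip
  rw [inner_sub_left, he, mul_one] at hcs
  rw [one_smul] at *
  linarith

/-! ### Dissipation of the slow dynamics -/

section
variable {ι : Type*} [Fintype ι]

/-- The sector term `φ (L y · w - |w|²)` with a suitable weight absorbs the product `μ y · w`, at the
cost of an arbitrarily small multiple of `|y|²`, and leaves strict damping of `w`. -/
theorem exists_sector_weight {L μ η : ℝ} (hL : 0 ≤ L) (hμ : 0 < μ) (hη : 0 < η) :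
    ∃ φ : ℝ, 0 < φ ∧ ∃ δ : ℝ, 0 < δ ∧ ∀ y w : ι → ℝ,
      (φ * L - μ) * (y ⬝ᵥ w) - φ * (w ⬝ᵥ w) ≤ η * (y ⬝ᵥ y) - δ * (w ⬝ᵥ w) := by
  rcases hL.eq_or_lt with rfl | hL
  · refine ⟨μ ^ 2 / η + 1, by positivity, 1, one_pos, fun y w ↦ ?_⟩
    have h := dotProduct_le_young (-μ • w) y hη
    simp only [smul_dotProduct, dotProduct_smul, smul_eq_mul, dotProduct_comm w y] at h
    have h2 : η⁻¹ * (-μ * (-μ * (w ⬝ᵥ w))) = μ ^ 2 / η * (w ⬝ᵥ w) := by ring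
    linarith
  · refine ⟨μ / L, by positivity, μ / L, by positivity, fun y w ↦ ?_⟩
    rw [div_mul_cancel₀ _ hL.ne']
    have := mul_nonneg hη.le (dotProduct_self_nonneg_real y)
    linarith
end

section
variable {r p₁ p₂ : ℕ}

/-- The rate of change of `(T u) · l` along the slow dynamics
`u' = -m u - w₁ - Gᵀ w₂ - μ⁻¹ Tᵀ e - Tᵀ l`, `l' = e`. The third input of the closed loop is
`w₃ = e + μ l`, so that `μ⁻¹ Tᵀ w₃ = μ⁻¹ Tᵀ e + Tᵀ l`. -/
noncomputable def crossRate (T : Matrix (Fin p₂) (Fin r) ℝ) (G : Matrix (Fin p₁) (Fin r) ℝ)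
    (m μ : ℝ) (u : Fin r → ℝ) (l e : Fin p₂ → ℝ) (w₁ : Fin r → ℝ) (w₂ : Fin p₁ → ℝ) : ℝ :=
  (Tᵀ *ᵥ l) ⬝ᵥ (-m • u - w₁ - Gᵀ *ᵥ w₂ - μ⁻¹ • Tᵀ *ᵥ e - Tᵀ *ᵥ l) + (T *ᵥ u) ⬝ᵥ e

/-- The cross term of the storage function damps `l` because `T Tᵀ` is positive definite. -/
theorem exists_crossRate_le {T : Matrix (Fin p₂) (Fin r) ℝ} (hT : (T * Tᵀ).PosDef)
    (G : Matrix (Fin p₁) (Fin r) ℝ) (m μ : ℝ) :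
    ∃ c : ℝ, 0 < c ∧ ∃ K : ℝ, 0 < K ∧ ∀ u l e w₁ w₂,
      crossRate T G m μ u l e w₁ w₂ ≤
        -c * (l ⬝ᵥ l) + K * (u ⬝ᵥ u + e ⬝ᵥ e + w₁ ⬝ᵥ w₁ + w₂ ⬝ᵥ w₂) := by
  obtain ⟨c, hc, hcl⟩ := hT.exists_le_dotProduct_mulVec
  have ht : 0 < c / 8 := by positivity
  obtain ⟨K₁, hK₁, h₁⟩ := exists_dotProduct_mulVec_le (-m • Tᵀ) ht
  obtain ⟨K₂, hK₂, h₂⟩ := exists_dotProduct_mulVec_le (-Tᵀ) ht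
  obtain ⟨K₃, hK₃, h₃⟩ := exists_dotProduct_mulVec_le (-(G * Tᵀ)) ht
  obtain ⟨K₄, hK₄, h₄⟩ := exists_dotProduct_mulVec_le (-μ⁻¹ • (T * Tᵀ)) ht
  obtain ⟨K₅, hK₅, h₅⟩ := exists_dotProduct_mulVec_le T one_pos
  refine ⟨c / 2, by positivity, K₁ + K₂ + K₃ + K₄ + K₅ + 1, by positivity,
    fun u l e w₁ w₂ ↦ ?_⟩
  have hu := dotProduct_self_nonneg_real u
  have he := dotProduct_self_nonneg_real e
  have hw₁ := dotProduct_self_nonneg_real w₁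
  have hw₂ := dotProduct_self_nonneg_real w₂
  have i₁ := h₁ u l
  have i₂ := h₂ w₁ l
  have i₃ := h₃ w₂ l
  have i₄ := h₄ e l
  have i₅ := h₅ e u
  have i₆ := hcl l
  have e₃ : (Tᵀ *ᵥ l) ⬝ᵥ (Gᵀ *ᵥ w₂) = w₂ ⬝ᵥ (G *ᵥ (Tᵀ *ᵥ l)) := by
    rw [dotProduct_mulVec, vecMul_transpose, dotProduct_comm]
  have e₄ : (Tᵀ *ᵥ l) ⬝ᵥ (Tᵀ *ᵥ e) = e ⬝ᵥ (T *ᵥ (Tᵀ *ᵥ l)) := by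
    rw [dotProduct_mulVec, vecMul_transpose, dotProduct_comm]
  have e₆ : (Tᵀ *ᵥ l) ⬝ᵥ (Tᵀ *ᵥ l) = l ⬝ᵥ (T *ᵥ (Tᵀ *ᵥ l)) := by
    rw [dotProduct_mulVec, vecMul_transpose, dotProduct_comm]
  simp only [neg_mulVec, smul_mulVec, ← mulVec_mulVec, dotProduct_neg, dotProduct_smul, smul_eq_mul]
    at i₁ i₂ i₃ i₄ i₅ i₆
  simp only [crossRate, dotProduct_sub, dotProduct_smul, smul_eq_mul, e₃, e₄, e₆,
    dotProduct_comm (Tᵀ *ᵥ l) u, dotProduct_comm (Tᵀ *ᵥ l) w₁, dotProduct_comm (T *ᵥ u) e]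
  have nn : ∀ {a b : ℝ}, 0 < a → 0 ≤ b → 0 ≤ a * b := fun ha hb ↦ mul_nonneg ha.le hb
  linarith [nn hK₁ he, nn hK₁ hw₁, nn hK₁ hw₂, nn hK₂ hu, nn hK₂ he, nn hK₂ hw₂, nn hK₃ hu,
    nn hK₃ he, nn hK₃ hw₁, nn hK₄ hu, nn hK₄ hw₁, nn hK₄ hw₂, nn hK₅ hu, nn hK₅ hw₁, nn hK₅ hw₂]

/-- The storage function `μ |u|² + μ |l|² + 2 q (T u) · l` of the slow dynamics is positive definite
and dissipates strictly in all variables. The sign of `L₁` matters only if there is an input at all: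
for `r = 0` the modulus `m` is not bounded by the Lipschitz constant of the gradient. -/
theorem exists_reduced_dissipation {T : Matrix (Fin p₂) (Fin r) ℝ} (hT : (T * Tᵀ).PosDef)
    (G : Matrix (Fin p₁) (Fin r) ℝ) {m μ L₁ L₂ : ℝ} (hm : 0 < m) (hμ : 0 < μ)
    (hL₁ : 0 < r → 0 ≤ L₁) (hL₂ : 0 ≤ L₂) :
    ∃ q φ₁ φ₂ δ c K : ℝ, 0 < φ₁ ∧ 0 < φ₂ ∧ 0 < δ ∧ 0 < c ∧ 0 < K ∧
      (∀ u l, c * (u ⬝ᵥ u + l ⬝ᵥ l) ≤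
        μ * (u ⬝ᵥ u) + μ * (l ⬝ᵥ l) + 2 * q * ((T *ᵥ u) ⬝ᵥ l)) ∧
      (∀ u l, μ * (u ⬝ᵥ u) + μ * (l ⬝ᵥ l) + 2 * q * ((T *ᵥ u) ⬝ᵥ l) ≤
        K * (u ⬝ᵥ u + l ⬝ᵥ l)) ∧
      ∀ u l e w₁ w₂,
        -(μ * m) * (u ⬝ᵥ u) - e ⬝ᵥ e
          + ((φ₁ * L₁ - μ) * (u ⬝ᵥ w₁) - φ₁ * (w₁ ⬝ᵥ w₁))
          + ((φ₂ * L₂ - μ) * ((G *ᵥ u) ⬝ᵥ w₂) - φ₂ * (w₂ ⬝ᵥ w₂))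
          + q * crossRate T G m μ u l e w₁ w₂ ≤
        -δ * (u ⬝ᵥ u + l ⬝ᵥ l + e ⬝ᵥ e + w₁ ⬝ᵥ w₁ + w₂ ⬝ᵥ w₂) := by
  -- for `r = 0` the vectors are empty and every weight works
  have hweight : ∃ φ : ℝ, 0 < φ ∧ ∃ δ : ℝ, 0 < δ ∧ ∀ y w : Fin r → ℝ,
      (φ * L₁ - μ) * (y ⬝ᵥ w) - φ * (w ⬝ᵥ w) ≤ μ * m / 4 * (y ⬝ᵥ y) - δ * (w ⬝ᵥ w) := by
    rcases Nat.eq_zero_or_pos r with rfl | hr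
    · exact ⟨1, one_pos, 1, one_pos, fun y w ↦ by simp⟩
    · exact exists_sector_weight (hL₁ hr) hμ (by positivity)
  obtain ⟨φ₁, hφ₁, δ₁, hδ₁, h₁⟩ := hweight
  obtain ⟨KG, hKG, hG⟩ := exists_mulVec_dotProduct_self_le G
  obtain ⟨φ₂, hφ₂, δ₂, hδ₂, h₂⟩ := exists_sector_weight (ι := Fin p₁) hL₂ hμ
    (η := μ * m / (4 * KG)) (by positivity)
  obtain ⟨c, hc, K, hK, hcross⟩ := exists_crossRate_le hT G m μ
  obtain ⟨KT, hKT, hTl⟩ := exists_dotProduct_mulVec_le T one_pos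
  obtain ⟨KT', hKT', hTl'⟩ := exists_dotProduct_mulVec_le (-T) one_pos
  obtain ⟨d, hd, hd1, hdm, hdδ₁, hdδ₂⟩ :
      ∃ d : ℝ, 0 < d ∧ d ≤ 1 ∧ d ≤ μ * m / 2 ∧ d ≤ δ₁ ∧ d ≤ δ₂ :=
    ⟨min (min 1 (μ * m / 2)) (min δ₁ δ₂), by positivity, by simp, by simp, by simp, by simp⟩
  obtain ⟨q, hq, hqK, hqμ⟩ : ∃ q : ℝ, 0 < q ∧ q * K ≤ d / 2 ∧ q * (2 * (KT' + 1)) ≤ μ / 2 := by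
    refine ⟨min (d / 2 / K) (μ / 2 / (2 * (KT' + 1))), by positivity, ?_, ?_⟩
    · exact (le_div_iff₀ hK).1 (min_le_left _ _)
    · exact (le_div_iff₀ (by positivity)).1 (min_le_right _ _)
  refine ⟨q, φ₁, φ₂, min (d / 2) (q * c), μ / 2, μ + 2 * q * (KT + 1), hφ₁, hφ₂,
    by positivity, by positivity, by positivity, fun u l ↦ ?_, fun u l ↦ ?_, fun u l e w₁ w₂ ↦ ?_⟩
  · have h := hTl' l u
    have hu := dotProduct_self_nonneg_real u
    have hl := dotProduct_self_nonneg_real l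
    rw [neg_mulVec, dotProduct_neg, dotProduct_comm] at h
    have h' : -((T *ᵥ u) ⬝ᵥ l) ≤ (KT' + 1) * (u ⬝ᵥ u + l ⬝ᵥ l) := by
      linarith [mul_nonneg hKT'.le hu]
    have := mul_le_mul_of_nonneg_left h' (by positivity : 0 ≤ 2 * q)
    have := mul_le_mul_of_nonneg_right hqμ (add_nonneg hu hl)
    linarith
  · have h := hTl l u
    have hu := dotProduct_self_nonneg_real u
    have hl := dotProduct_self_nonneg_real l
    rw [dotProduct_comm] at h
    have h' : (T *ᵥ u) ⬝ᵥ l ≤ (KT + 1) * (u ⬝ᵥ u + l ⬝ᵥ l) := by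
      linarith [mul_nonneg hKT.le hu]
    have := mul_le_mul_of_nonneg_left h' (by positivity : 0 ≤ 2 * q)
    linarith
  · have hu := dotProduct_self_nonneg_real u
    have hl := dotProduct_self_nonneg_real l
    have he := dotProduct_self_nonneg_real e
    have hw₁ := dotProduct_self_nonneg_real w₁
    have hw₂ := dotProduct_self_nonneg_real w₂
    have i₁ := h₁ u w₁
    have i₂ := h₂ (G *ᵥ u) w₂
    have i₃ := mul_le_mul_of_nonneg_left (hcross u l e w₁ w₂) hq.le
    have i₄ : μ * m / (4 * KG) * ((G *ᵥ u) ⬝ᵥ (G *ᵥ u)) ≤ μ * m / 4 * (u ⬝ᵥ u) := by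
      have := mul_le_mul_of_nonneg_left (hG u) (by positivity : 0 ≤ μ * m / (4 * KG))
      have h' : μ * m / (4 * KG) * (KG * (u ⬝ᵥ u)) = μ * m / 4 * (u ⬝ᵥ u) := by field_simp
      linarith
    have i₅ := mul_le_mul_of_nonneg_right hqK (by positivity :
      0 ≤ u ⬝ᵥ u + e ⬝ᵥ e + w₁ ⬝ᵥ w₁ + w₂ ⬝ᵥ w₂)
    have i₆ := mul_le_mul_of_nonneg_right (min_le_left (d / 2) (q * c)) (by positivity :
      0 ≤ u ⬝ᵥ u + e ⬝ᵥ e + w₁ ⬝ᵥ w₁ + w₂ ⬝ᵥ w₂)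
    have i₇ := mul_le_mul_of_nonneg_right (min_le_right (d / 2) (q * c)) hl
    have i₈ := mul_le_mul_of_nonneg_right hd1 he
    have i₉ := mul_le_mul_of_nonneg_right hdm hu
    have i₁₀ := mul_le_mul_of_nonneg_right hdδ₁ hw₁
    have i₁₁ := mul_le_mul_of_nonneg_right hdδ₂ hw₂
    linarith
end

/-! ### Quadratic forms of the block matrices -/

theorem blocks3_mulVec {a b c d e k : Type*} [Fintype d] [Fintype e] [Fintype k]
    (M₁₁ : Matrix a d ℝ) (M₁₂ : Matrix a e ℝ) (M₁₃ : Matrix a k ℝ)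
    (M₂₁ : Matrix b d ℝ) (M₂₂ : Matrix b e ℝ) (M₂₃ : Matrix b k ℝ)
    (M₃₁ : Matrix c d ℝ) (M₃₂ : Matrix c e ℝ) (M₃₃ : Matrix c k ℝ)
    (x : d → ℝ) (y : e → ℝ) (z : k → ℝ) :
    blocks3 M₁₁ M₁₂ M₁₃ M₂₁ M₂₂ M₂₃ M₃₁ M₃₂ M₃₃ *ᵥ Sum.elim x (Sum.elim y z) =
      Sum.elim (M₁₁ *ᵥ x + M₁₂ *ᵥ y + M₁₃ *ᵥ z)
        (Sum.elim (M₂₁ *ᵥ x + M₂₂ *ᵥ y + M₂₃ *ᵥ z) (M₃₁ *ᵥ x + M₃₂ *ᵥ y + M₃₃ *ᵥ z)) := by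
  ext (i | i | i) <;>
  simp [blocks3, fromBlocks_mulVec, fromRows_mulVec, add_assoc]

theorem blocks3_transpose {a b c d e k : Type*}
    (M₁₁ : Matrix a d ℝ) (M₁₂ : Matrix a e ℝ) (M₁₃ : Matrix a k ℝ)
    (M₂₁ : Matrix b d ℝ) (M₂₂ : Matrix b e ℝ) (M₂₃ : Matrix b k ℝ)
    (M₃₁ : Matrix c d ℝ) (M₃₂ : Matrix c e ℝ) (M₃₃ : Matrix c k ℝ) :
    (blocks3 M₁₁ M₁₂ M₁₃ M₂₁ M₂₂ M₂₃ M₃₁ M₃₂ M₃₃)ᵀ =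
      blocks3 M₁₁ᵀ M₂₁ᵀ M₃₁ᵀ M₁₂ᵀ M₂₂ᵀ M₃₂ᵀ M₁₃ᵀ M₂₃ᵀ M₃₃ᵀ := by
  ext (i | i | i) (j | j | j) <;> rfl

section lmi
variable {σ τ : Type*} [Fintype σ] [Fintype τ] [DecidableEq τ]

theorem lmiMatrix_transpose (A : Matrix σ σ ℝ) (B : Matrix σ τ ℝ) (C : Matrix τ σ ℝ)
    {P : Matrix σ σ ℝ} {Ξ : Matrix (τ ⊕ τ) (τ ⊕ τ) ℝ} (hP : Pᵀ = P) (hΞ : Ξᵀ = Ξ) :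
    (lmiMatrix A B C P Ξ)ᵀ = lmiMatrix A B C P Ξ := by
  simp [lmiMatrix, fromBlocks_transpose, transpose_mul, hP, hΞ, Matrix.mul_assoc, add_comm]

/-- The quadratic form of the matrix inequality is the derivative of the storage function plus the
multiplier evaluated at the output and input. -/
theorem dotProduct_lmiMatrix_mulVec (A : Matrix σ σ ℝ) (B : Matrix σ τ ℝ) (C : Matrix τ σ ℝ)
    {P : Matrix σ σ ℝ} (Ξ : Matrix (τ ⊕ τ) (τ ⊕ τ) ℝ) (hP : Pᵀ = P) (z : σ → ℝ) (w : τ → ℝ) :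
    Sum.elim z w ⬝ᵥ (lmiMatrix A B C P Ξ *ᵥ Sum.elim z w) =
      2 * ((P *ᵥ z) ⬝ᵥ (A *ᵥ z + B *ᵥ w)) +
        Sum.elim (C *ᵥ z) w ⬝ᵥ (Ξ *ᵥ Sum.elim (C *ᵥ z) w) := by
  have hP' : ∀ v, z ⬝ᵥ (P *ᵥ v) = (P *ᵥ z) ⬝ᵥ v := fun v ↦ by
    rw [dotProduct_mulVec, ← mulVec_transpose, hP]
  have hA : z ⬝ᵥ (Aᵀ *ᵥ (P *ᵥ z)) = (P *ᵥ z) ⬝ᵥ (A *ᵥ z) := by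
    rw [dotProduct_mulVec, vecMul_transpose, dotProduct_comm]
  have hB : w ⬝ᵥ (Bᵀ *ᵥ (P *ᵥ z)) = (P *ᵥ z) ⬝ᵥ (B *ᵥ w) := by
    rw [dotProduct_mulVec, vecMul_transpose, dotProduct_comm]
  have hC : fromBlocks C 0 0 (1 : Matrix τ τ ℝ) *ᵥ Sum.elim z w = Sum.elim (C *ᵥ z) w := by
    simp [fromBlocks_mulVec]
  have hC' : (fromBlocks Cᵀ 0 0 (1 : Matrix τ τ ℝ)) = (fromBlocks C 0 0 (1 : Matrix τ τ ℝ))ᵀ := by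
    simp [fromBlocks_transpose]
  rw [lmiMatrix, add_mulVec, dotProduct_add, ← mulVec_mulVec, ← mulVec_mulVec, hC, hC',
    dotProduct_mulVec (Sum.elim z w) (fromBlocks C 0 0 1)ᵀ, vecMul_transpose, hC]
  congr 1
  simp only [fromBlocks_mulVec, Sum.elim_comp_inl, Sum.elim_comp_inr, sumElim_dotProduct_sumElim,
    add_mulVec, dotProduct_add, ← mulVec_mulVec, hA, hB, hP', zero_mulVec, dotProduct_zero]
  ring

end lmi

section
variable {n r p₁ p₂ : ℕ}

theorem multiplier_transpose (L₁ L₂ φ₁ φ₂ : ℝ) :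
    (multiplier r p₁ p₂ L₁ L₂ φ₁ φ₂)ᵀ = multiplier r p₁ p₂ L₁ L₂ φ₁ φ₂ := by
  simp [multiplier, fromBlocks_transpose, blocks3_transpose]

theorem dotProduct_multiplier_mulVec (L₁ L₂ φ₁ φ₂ : ℝ) (y₁ w₁ : Fin r → ℝ) (y₂ w₂ : Fin p₁ → ℝ)
    (y₃ w₃ : Fin p₂ → ℝ) :
    Sum.elim (Sum.elim y₁ (Sum.elim y₂ y₃)) (Sum.elim w₁ (Sum.elim w₂ w₃)) ⬝ᵥ
      (multiplier r p₁ p₂ L₁ L₂ φ₁ φ₂ *ᵥ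
        Sum.elim (Sum.elim y₁ (Sum.elim y₂ y₃)) (Sum.elim w₁ (Sum.elim w₂ w₃))) =
      2 * (φ₁ * L₁ * (y₁ ⬝ᵥ w₁) - φ₁ * (w₁ ⬝ᵥ w₁) + (φ₂ * L₂ * (y₂ ⬝ᵥ w₂) - φ₂ * (w₂ ⬝ᵥ w₂)) +
        (y₃ ⬝ᵥ w₃ - w₃ ⬝ᵥ w₃)) := by
  simp only [multiplier, fromBlocks_mulVec, Sum.elim_comp_inl, Sum.elim_comp_inr, blocks3_mulVec,
    sumElim_dotProduct_sumElim, zero_mulVec, smul_mulVec, one_mulVec, dotProduct_add,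
    dotProduct_smul, smul_eq_mul, zero_add, add_zero,
    dotProduct_comm w₁ y₁, dotProduct_comm w₂ y₂, dotProduct_comm w₃ y₃]
  ring

/-! ### The storage function of the closed loop -/

/-- The matrix of the storage function
`ξᵀ X ξ + μ |u|² + μ |l|² + 2 q (T u) · l`, `ξ = x - H u`, in the coordinates `(x, u, l)`. -/
def storageMatrix (X : Matrix (Fin n) (Fin n) ℝ) (H : Matrix (Fin n) (Fin r) ℝ)
    (T : Matrix (Fin p₂) (Fin r) ℝ) (μ q : ℝ) :
    Matrix (StateIdx n r p₂) (StateIdx n r p₂) ℝ :=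
  blocks3
    X (-(X * H)) 0
    (-(Hᵀ * X)) (Hᵀ * X * H + μ • (1 : Matrix (Fin r) (Fin r) ℝ)) (q • Tᵀ)
    0 (q • T) (μ • (1 : Matrix (Fin p₂) (Fin p₂) ℝ))

variable {X : Matrix (Fin n) (Fin n) ℝ} (H : Matrix (Fin n) (Fin r) ℝ)
    (T : Matrix (Fin p₂) (Fin r) ℝ) (μ q : ℝ)

theorem storageMatrix_transpose (hX : Xᵀ = X) :
    (storageMatrix X H T μ q)ᵀ = storageMatrix X H T μ q := by
  simp [storageMatrix, blocks3_transpose, hX, Matrix.mul_assoc]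

theorem storageMatrix_mulVec (X : Matrix (Fin n) (Fin n) ℝ)
    (x : Fin n → ℝ) (u : Fin r → ℝ) (l : Fin p₂ → ℝ) :
    storageMatrix X H T μ q *ᵥ Sum.elim (x + H *ᵥ u) (Sum.elim u l) =
      Sum.elim (X *ᵥ x)
        (Sum.elim (-(Hᵀ *ᵥ (X *ᵥ x)) + μ • u + q • Tᵀ *ᵥ l) (q • T *ᵥ u + μ • l)) := by
  simp only [storageMatrix, blocks3_mulVec, neg_mulVec, ← mulVec_mulVec, add_mulVec, smul_mulVec,
    one_mulVec, zero_mulVec, mulVec_add]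
  congr 1
  · abel
  · congr 1
    · abel
    · abel

theorem dotProduct_storageMatrix_mulVec (X : Matrix (Fin n) (Fin n) ℝ)
    (x : Fin n → ℝ) (u : Fin r → ℝ) (l : Fin p₂ → ℝ) :
    Sum.elim (x + H *ᵥ u) (Sum.elim u l) ⬝ᵥ
      (storageMatrix X H T μ q *ᵥ Sum.elim (x + H *ᵥ u) (Sum.elim u l)) =
      x ⬝ᵥ (X *ᵥ x) + (μ * (u ⬝ᵥ u) + μ * (l ⬝ᵥ l) + 2 * q * ((T *ᵥ u) ⬝ᵥ l)) := by
  have h1 : u ⬝ᵥ (Hᵀ *ᵥ (X *ᵥ x)) = (H *ᵥ u) ⬝ᵥ (X *ᵥ x) := by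
    rw [dotProduct_mulVec, vecMul_transpose]
  have h2 : u ⬝ᵥ (Tᵀ *ᵥ l) = (T *ᵥ u) ⬝ᵥ l := by
    rw [dotProduct_mulVec, vecMul_transpose]
  rw [storageMatrix_mulVec]
  simp only [sumElim_dotProduct_sumElim, add_dotProduct, dotProduct_add, dotProduct_neg,
    dotProduct_smul, smul_eq_mul, h1, h2, dotProduct_comm l (T *ᵥ u)]
  ring

/-- The form of the matrix inequality in the coordinates `x` (deviation from the quasi-steady state
`H u`), `u`, `l`, `w₁`, `w₂` and `e = w₃ - μ l`. It splits into the fast part with factor `ε⁻¹`, the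
coupling, the slow part and the shift. -/
theorem dotProduct_closedLoop_lmiMatrix_mulVec {A : Matrix (Fin n) (Fin n) ℝ}
    {B : Matrix (Fin n) (Fin r) ℝ}
    {C₁ : Matrix (Fin p₁) (Fin n) ℝ} {C₂ : Matrix (Fin p₂) (Fin n) ℝ}
    {G : Matrix (Fin p₁) (Fin r) ℝ} (hX : Xᵀ = X) (hAH : A * H = -B)
    (hG : dcGain A B C₁ = G) (hT : dcGain A B C₂ = T) (hGH : C₁ * H = G) (hTH : C₂ * H = T)
    (m ε ρ L₁ L₂ φ₁ φ₂ : ℝ) (hμ : μ ≠ 0)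
    (x : Fin n → ℝ) (u w₁ : Fin r → ℝ) (l e : Fin p₂ → ℝ) (w₂ : Fin p₁ → ℝ) :
    Sum.elim (Sum.elim (x + H *ᵥ u) (Sum.elim u l)) (Sum.elim w₁ (Sum.elim w₂ (e + μ • l))) ⬝ᵥ
      (lmiMatrix (bigAShift p₂ A B m μ ε ρ) (bigB A B C₁ C₂ μ) (bigC r C₁ C₂ μ)
        (storageMatrix X H T μ q) (multiplier r p₁ p₂ L₁ L₂ φ₁ φ₂) *ᵥ
      Sum.elim (Sum.elim (x + H *ᵥ u) (Sum.elim u l)) (Sum.elim w₁ (Sum.elim w₂ (e + μ • l)))) =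
    2 * (ε⁻¹ * ((X *ᵥ x) ⬝ᵥ (A *ᵥ x))
      - (X *ᵥ x) ⬝ᵥ (H *ᵥ (-m • u - w₁ - Gᵀ *ᵥ w₂ - μ⁻¹ • Tᵀ *ᵥ e - Tᵀ *ᵥ l))
      + φ₂ * L₂ * ((C₁ *ᵥ x) ⬝ᵥ w₂) + (C₂ *ᵥ x) ⬝ᵥ (e + μ • l)
      + (-(μ * m) * (u ⬝ᵥ u) - e ⬝ᵥ e
          + ((φ₁ * L₁ - μ) * (u ⬝ᵥ w₁) - φ₁ * (w₁ ⬝ᵥ w₁))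
          + ((φ₂ * L₂ - μ) * ((G *ᵥ u) ⬝ᵥ w₂) - φ₂ * (w₂ ⬝ᵥ w₂))
          + q * crossRate T G m μ u l e w₁ w₂)
      + ρ * (x ⬝ᵥ (X *ᵥ x) + (μ * (u ⬝ᵥ u) + μ * (l ⬝ᵥ l) + 2 * q * ((T *ᵥ u) ⬝ᵥ l)))) := by
  -- the controller velocity, written in the coordinates `u, l, e, w₁, w₂`
  set v := -m • u - w₁ - Gᵀ *ᵥ w₂ - μ⁻¹ • Tᵀ *ᵥ e - Tᵀ *ᵥ l with hv
  have hz : bigAShift p₂ A B m μ ε ρ *ᵥ Sum.elim (x + H *ᵥ u) (Sum.elim u l) +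
      bigB A B C₁ C₂ μ *ᵥ Sum.elim w₁ (Sum.elim w₂ (e + μ • l)) =
      Sum.elim (ε⁻¹ • A *ᵥ x) (Sum.elim v e) +
        ρ • Sum.elim (x + H *ᵥ u) (Sum.elim u l) := by
    rw [bigAShift, add_mulVec, smul_mulVec, one_mulVec, bigA, blocks3_mulVec, bigB, blocks3_mulVec,
      hG, hT, add_right_comm]
    congr 1
    rw [← Sum.elim_add_add, ← Sum.elim_add_add]
    congr 1
    · simp [mulVec_add, hAH, neg_mulVec, smul_mulVec]
    · congr 1
      · simp only [hv, mulVec_add, mulVec_smul, smul_mulVec, one_mulVec, zero_mulVec, neg_mulVec,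
          one_div, neg_smul, smul_neg, smul_inv_smul₀ hμ]
        abel
      · simp [neg_mulVec, smul_mulVec]
  have hy : bigC r C₁ C₂ μ *ᵥ Sum.elim (x + H *ᵥ u) (Sum.elim u l) =
      Sum.elim u (Sum.elim (C₁ *ᵥ x + G *ᵥ u) (C₂ *ᵥ x + T *ᵥ u + μ • l)) := by
    rw [bigC, blocks3_mulVec]
    simp [mulVec_add, hGH, hTH, smul_mulVec]
  rw [dotProduct_lmiMatrix_mulVec _ _ _ _ (storageMatrix_transpose H T μ q hX), hz, hy,
    dotProduct_multiplier_mulVec, dotProduct_add, dotProduct_smul,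
    dotProduct_comm _ (Sum.elim (x + H *ᵥ u) _), dotProduct_storageMatrix_mulVec,
    storageMatrix_mulVec]
  have h1 : (Hᵀ *ᵥ (X *ᵥ x)) ⬝ᵥ v = (X *ᵥ x) ⬝ᵥ (H *ᵥ v) := by
    rw [dotProduct_mulVec, mulVec_transpose]
  have h2 : u ⬝ᵥ v = -m * (u ⬝ᵥ u) - u ⬝ᵥ w₁ - (G *ᵥ u) ⬝ᵥ w₂ - μ⁻¹ * ((T *ᵥ u) ⬝ᵥ e)
      - (T *ᵥ u) ⬝ᵥ l := by
    simp only [hv, dotProduct_sub, dotProduct_smul, smul_eq_mul, dotProduct_mulVec,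
      vecMul_transpose]
  simp only [sumElim_dotProduct_sumElim, add_dotProduct, dotProduct_add, neg_dotProduct,
    smul_dotProduct, dotProduct_smul, smul_eq_mul, h1, h2, crossRate, ← hv, dotProduct_comm l e]
  field_simp
  ring

/-- The coupling between the fast variable `x` and the slow ones is dominated by a small multiple of
the slow variables and a large multiple of `x`, uniformly in the time-scale parameter. -/
theorem exists_coupling_le (X : Matrix (Fin n) (Fin n) ℝ) (C₁ : Matrix (Fin p₁) (Fin n) ℝ)
    (C₂ : Matrix (Fin p₂) (Fin n) ℝ) (G : Matrix (Fin p₁) (Fin r) ℝ) (m k : ℝ) {δ : ℝ}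
    (hδ : 0 < δ) (hX : Xᵀ = X) :
    ∃ K : ℝ, 0 < K ∧ ∀ (x : Fin n → ℝ) (u : Fin r → ℝ) (l e : Fin p₂ → ℝ) (w₁ : Fin r → ℝ)
      (w₂ : Fin p₁ → ℝ),
      - (X *ᵥ x) ⬝ᵥ (H *ᵥ (-m • u - w₁ - Gᵀ *ᵥ w₂ - μ⁻¹ • Tᵀ *ᵥ e - Tᵀ *ᵥ l))
      + k * ((C₁ *ᵥ x) ⬝ᵥ w₂) + (C₂ *ᵥ x) ⬝ᵥ (e + μ • l) ≤
      K * (x ⬝ᵥ x) + δ * (u ⬝ᵥ u + l ⬝ᵥ l + e ⬝ᵥ e + w₁ ⬝ᵥ w₁ + w₂ ⬝ᵥ w₂) := by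
  obtain ⟨K₁, hK₁, h₁⟩ := exists_dotProduct_mulVec_le (m • (X * H)) hδ
  obtain ⟨K₂, hK₂, h₂⟩ := exists_dotProduct_mulVec_le (X * H) hδ
  obtain ⟨K₃, hK₃, h₃⟩ := exists_dotProduct_mulVec_le (X * H * Gᵀ + k • C₁ᵀ) hδ
  obtain ⟨K₄, hK₄, h₄⟩ := exists_dotProduct_mulVec_le (μ⁻¹ • (X * H * Tᵀ) + C₂ᵀ) hδ
  obtain ⟨K₅, hK₅, h₅⟩ := exists_dotProduct_mulVec_le (X * H * Tᵀ + μ • C₂ᵀ) hδ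
  refine ⟨K₁ + K₂ + K₃ + K₄ + K₅, by positivity, fun x u l e w₁ w₂ ↦ ?_⟩
  have i₁ := h₁ x u
  have i₂ := h₂ x w₁
  have i₃ := h₃ x w₂
  have i₄ := h₄ x e
  have i₅ := h₅ x l
  have hX' : ∀ v, x ⬝ᵥ (X *ᵥ v) = (X *ᵥ x) ⬝ᵥ v := fun v ↦ by
    rw [dotProduct_mulVec, ← mulVec_transpose, hX]
  have hC₁ : x ⬝ᵥ (C₁ᵀ *ᵥ w₂) = (C₁ *ᵥ x) ⬝ᵥ w₂ := by rw [dotProduct_mulVec, vecMul_transpose]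
  have hC₂ : ∀ v, x ⬝ᵥ (C₂ᵀ *ᵥ v) = (C₂ *ᵥ x) ⬝ᵥ v := fun v ↦ by
    rw [dotProduct_mulVec, vecMul_transpose]
  simp only [add_mulVec, smul_mulVec, ← mulVec_mulVec, dotProduct_add, dotProduct_smul,
    smul_eq_mul, hX', hC₁, hC₂] at i₁ i₂ i₃ i₄ i₅
  simp only [mulVec_sub, mulVec_smul, neg_dotProduct, dotProduct_sub, dotProduct_add,
    dotProduct_smul, smul_eq_mul]
  linarith
end

/-! ### Solvability of the linear matrix inequality -/

theorem theorem2 {n r p₁ p₂ : ℕ}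
    (A : Matrix (Fin n) (Fin n) ℝ) (B : Matrix (Fin n) (Fin r) ℝ)
    (C₁ : Matrix (Fin p₁) (Fin n) ℝ) (C₂ : Matrix (Fin p₂) (Fin n) ℝ)
    (hA : IsHurwitz A)
    (m : ℝ) (hm : 0 < m) (Lf Lh : ℝ≥0)
    (f : ℝ → EuclideanSpace ℝ (Fin r) → ℝ)
    (h : ℝ → EuclideanSpace ℝ (Fin p₁) → ℝ)
    (g : ℝ → EuclideanSpace ℝ (Fin p₂) → EReal)
    (hcost : CostAssumption m Lf Lh f h g)
    (μ : ℝ) (hμ : 0 < μ) (hμL : max ((Lf : ℝ) - m) (Lh : ℝ) ≤ μ)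
    (hrank : (dcGain A B C₂ * (dcGain A B C₂)ᵀ).PosDef) :
    ∃ ε₀ : ℝ, 0 < ε₀ ∧ ∀ ε : ℝ, 0 < ε → ε < ε₀ →
      ∃ (ρ φ₁ φ₂ : ℝ) (P : Matrix (StateIdx n r p₂) (StateIdx n r p₂) ℝ),
        0 < ρ ∧ 0 ≤ φ₁ ∧ 0 ≤ φ₂ ∧ P.PosDef ∧
          SatisfiesLMI (bigAShift p₂ A B m μ ε ρ) (bigB A B C₁ C₂ μ) (bigC r C₁ C₂ μ) P
            (multiplier r p₁ p₂ ((Lf : ℝ) - m) (Lh : ℝ) φ₁ φ₂) := by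
  have hL₁ : 0 < r → 0 ≤ (Lf : ℝ) - m := fun hr ↦ by
    have : Nonempty (Fin r) := ⟨⟨0, hr⟩⟩
    exact sub_nonneg.2 <| (hcost.f_strongConvex 0 le_rfl).le_of_lipschitzWith_gradient
      (hcost.f_differentiable 0 le_rfl) (hcost.f_lipschitz 0 le_rfl)
  obtain ⟨H, hH⟩ : ∃ H, H = ((0 : ℝ) • (1 : Matrix (Fin n) (Fin n) ℝ) - A)⁻¹ * B := ⟨_, rfl⟩
  have hAH : A * H = -B := by
    have hdet : IsUnit (-A).det := by
      rw [← isUnit_iff_isUnit_det, IsUnit.neg_iff, isUnit_iff_isUnit_det]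
      exact hA.isUnit_det
    rw [hH, zero_smul, zero_sub, ← neg_eq_iff_eq_neg, ← Matrix.neg_mul, ← Matrix.mul_assoc,
      mul_nonsing_inv _ hdet, Matrix.one_mul]
  have hGH : C₁ * H = dcGain A B C₁ := by rw [hH, dcGain, transferFn, Matrix.mul_assoc]
  have hTH : C₂ * H = dcGain A B C₂ := by rw [hH, dcGain, transferFn, Matrix.mul_assoc]
  obtain ⟨T, hT⟩ : ∃ T, dcGain A B C₂ = T := ⟨_, rfl⟩
  obtain ⟨G, hG⟩ : ∃ G, dcGain A B C₁ = G := ⟨_, rfl⟩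
  rw [hG] at hGH
  rw [hT] at hTH hrank
  obtain ⟨X, hXpos, κ, hκ, hlyap⟩ := hA.exists_lyapunov
  have hX : Xᵀ = X := by simpa [IsHermitian] using hXpos.isHermitian
  obtain ⟨q, φ₁, φ₂, δ, c, K, hφ₁, hφ₂, hδ, hc, hK, hlow, hup, hred⟩ :=
    exists_reduced_dissipation hrank G hm hμ hL₁ Lh.coe_nonneg
  obtain ⟨K₁, hK₁, hcoup⟩ :=
    exists_coupling_le H T μ X C₁ C₂ G m (φ₂ * Lh) (half_pos hδ) hX
  obtain ⟨K₂, hK₂, hXup⟩ := exists_dotProduct_mulVec_le X one_pos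
  have hP : (storageMatrix X H T μ q).PosDef := by
    refine Matrix.posDef_of_forall (storageMatrix_transpose H T μ q hX) fun z hz ↦ ?_
    obtain ⟨x, u, l, rfl⟩ : ∃ x u l, z = Sum.elim (x + H *ᵥ u) (Sum.elim u l) :=
      ⟨z ∘ Sum.inl - H *ᵥ (z ∘ Sum.inr ∘ Sum.inl), z ∘ Sum.inr ∘ Sum.inl, z ∘ Sum.inr ∘ Sum.inr,
        by ext (i | i | i) <;> simp⟩
    rw [dotProduct_storageMatrix_mulVec]
    obtain ⟨cX, hcX, hXlow⟩ := hXpos.exists_le_dotProduct_mulVec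
    have hx := dotProduct_self_nonneg_real x
    have hu := dotProduct_self_nonneg_real u
    have hl := dotProduct_self_nonneg_real l
    have h0 : 0 < cX * (x ⬝ᵥ x) + c * (u ⬝ᵥ u + l ⬝ᵥ l) := by
      refine lt_of_le_of_ne (by positivity) fun h0 ↦ hz ?_
      have := mul_nonneg hcX.le hx
      have := mul_nonneg hc.le (add_nonneg hu hl)
      have hx0 : x ⬝ᵥ x = 0 := by
        refine (mul_eq_zero.1 (?_ : cX * (x ⬝ᵥ x) = 0)).resolve_left hcX.ne'
        linarith
      have hul : u ⬝ᵥ u + l ⬝ᵥ l = 0 := by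
        refine (mul_eq_zero.1 (?_ : c * (u ⬝ᵥ u + l ⬝ᵥ l) = 0)).resolve_left hc.ne'
        linarith
      have hu0 : u ⬝ᵥ u = 0 := by linarith
      have hl0 : l ⬝ᵥ l = 0 := by linarith
      rw [dotProduct_self_eq_zero] at hx0 hu0 hl0
      subst hx0 hu0 hl0
      ext (i | i | i) <;> simp
    linarith [hXlow x, hlow u l]
  refine ⟨κ / (K₁ + 1), by positivity, fun ε hε hε₀ ↦ ?_⟩
  have hεκ : K₁ + 1 ≤ ε⁻¹ * κ := by
    rw [lt_div_iff₀ (by positivity)] at hε₀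
    rw [← div_eq_inv_mul, le_div_iff₀ hε]
    linarith
  obtain ⟨ρ, hρ, hρX, hρK⟩ : ∃ ρ : ℝ, 0 < ρ ∧ ρ * (K₂ + 1) ≤ 1 ∧ ρ * K ≤ δ / 2 :=
    ⟨min (1 / (K₂ + 1)) (δ / 2 / K), by positivity,
      (le_div_iff₀ (by positivity)).1 (min_le_left _ _), (le_div_iff₀ hK).1 (min_le_right _ _)⟩
  refine ⟨ρ, φ₁, φ₂, storageMatrix X H T μ q, hρ, hφ₁.le, hφ₂.le, hP, ?_⟩
  refine PosSemidef.of_dotProduct_mulVec_nonneg ?_ fun s ↦ ?_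
  · rw [IsHermitian, conjTranspose_eq_transpose_of_trivial, transpose_neg,
      lmiMatrix_transpose _ _ _ (storageMatrix_transpose H T μ q hX) (multiplier_transpose _ _ _ _)]
  obtain ⟨x, u, l, e, w₁, w₂, rfl⟩ : ∃ x u l e w₁ w₂, s =
      Sum.elim (Sum.elim (x + H *ᵥ u) (Sum.elim u l)) (Sum.elim w₁ (Sum.elim w₂ (e + μ • l))) :=
    ⟨s ∘ Sum.inl ∘ Sum.inl - H *ᵥ (s ∘ Sum.inl ∘ Sum.inr ∘ Sum.inl),
      s ∘ Sum.inl ∘ Sum.inr ∘ Sum.inl, s ∘ Sum.inl ∘ Sum.inr ∘ Sum.inr,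
      s ∘ Sum.inr ∘ Sum.inr ∘ Sum.inr - μ • (s ∘ Sum.inl ∘ Sum.inr ∘ Sum.inr),
      s ∘ Sum.inr ∘ Sum.inl, s ∘ Sum.inr ∘ Sum.inr ∘ Sum.inl,
      by ext ((i | i | i) | (i | i | i)) <;> simp⟩
  rw [star_trivial, neg_mulVec, dotProduct_neg,
    dotProduct_closedLoop_lmiMatrix_mulVec H T μ q hX hAH hG hT hGH hTH _ _ _ _ _ _ _ hμ.ne']
  have hx := dotProduct_self_nonneg_real x
  have hu := dotProduct_self_nonneg_real u
  have hl := dotProduct_self_nonneg_real l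
  have he := dotProduct_self_nonneg_real e
  have hw₁ := dotProduct_self_nonneg_real w₁
  have hw₂ := dotProduct_self_nonneg_real w₂
  have i₁ := mul_le_mul_of_nonneg_left (hlyap x) (inv_pos.2 hε).le
  have i₂ := mul_le_mul_of_nonneg_right hεκ hx
  have i₃ := hcoup x u l e w₁ w₂
  have i₄ := hred u l e w₁ w₂
  have i₅ := mul_le_mul_of_nonneg_left (hup u l) hρ.le
  have i₆ := mul_le_mul_of_nonneg_left (hXup x x) hρ.le
  have i₇ := mul_le_mul_of_nonneg_right hρX hx
  have i₈ := mul_le_mul_of_nonneg_right hρK (add_nonneg hu hl)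
  have i₉ := mul_nonneg hδ.le (add_nonneg (add_nonneg he hw₁) hw₂)
  rw [neg_dotProduct] at i₃
  linarith
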